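/- Let $N$ be a finitely generated torsion-free nilpotent group and let $h$ be its Hirsch length, that is, the number of infinite factors in any finite subnormal series of $N$ with cyclic factors. Suppose that $N$ is *filiform*: $h\ge 3$ and the nilpotency class (step length) of $N$ is $h-1$. For $g\in N\setminus\{1\}$ let $D_N(g)$ be the least order of a finite group $Q$ for which there is a surjective homomorphism $\varphi\colon N\to Q$ with $\varphi(g)\ne 1$ (and $D_N(g)=\infty$ if there is none). For a finite generating set $S$ of $N$, with word length $\|\cdot\|_S$, let $$F_{N,S}(n)=\max\{D_N(g) : g\in N\setminus\{1\},\ \|g\|_S\le n\}.$$ For functions $f,g$ on the positive integers with values in $[0,\infty]$ write $f\precsim g$ if there is an integer $C>0$ such that $f(n)\le C\,g(Cn)$ for all $n\ge 1$, and $f\approx g$ if $f\precsim g$ and $g\precsim f$. Then, for every finite generating set $S$ of $N$, $$F_{N,S}(n)\approx(\log n)^h .$$ In particular, if $N$ is the $3$-dimensional integral Heisenberg group, the group of upper triangular $3\times 3$ integer matrices with all diagonal entries $1$, then $F_{N,S}(n)\approx(\log n)^3$ for every finite generating set $S$ of $N$. -/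

import Mathlib

open scoped ENNReal

universe u

/-! ### Asymptotic comparison -/

/-- `f ≾ g`: there is a natural constant `C > 0` with `f n ≤ C * g (C * n)` for all `n ≥ 1`.
The values are taken in `[0, ∞]`, so that a possibly infinite function is never replaced
by a default value. -/
def AsympLE (f g : ℕ → ℝ≥0∞) : Prop :=
  ∃ C : ℕ, 0 < C ∧ ∀ n : ℕ, 1 ≤ n → f n ≤ C * g (C * n)

/-- `f ≈ g`: both `f ≾ g` and `g ≾ f`. -/
def AsympEquiv (f g : ℕ → ℝ≥0∞) : Prop :=
  AsympLE f g ∧ AsympLE g f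

/-- The function `n ↦ (log n) ^ h`. -/
noncomputable def logPow (h : ℕ) (n : ℕ) : ℝ≥0∞ :=
  ENNReal.ofReal (Real.log n ^ h)

/-! ### Quantifying residual finiteness -/

/-- `g` is a product of exactly `k` elements of `S ∪ S⁻¹`. -/
def IsWordProduct {G : Type u} [Group G] (S : Set G) (k : ℕ) (g : G) : Prop :=
  ∃ l : List G, l.length = k ∧ (∀ s ∈ l, s ∈ S ∨ s⁻¹ ∈ S) ∧ l.prod = g

/-- The word length `‖g‖_S` (`⊤` if `g` is not in the subgroup generated by `S`). -/
noncomputable def wordLength {G : Type u} [Group G] (S : Set G) (g : G) : ℕ∞ :=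
  sInf {k : ℕ∞ | ∃ m : ℕ, k = m ∧ IsWordProduct S m g}

/-- The depth `D_G(g)`: the least order of a finite quotient `φ : G ↠ Q` with `φ g ≠ 1`
(`⊤` if there is none). -/
noncomputable def depth {G : Type u} [Group G] (g : G) : ℕ∞ :=
  sInf {k : ℕ∞ | ∃ (Q : Type u) (_ : Group Q) (_ : Finite Q) (φ : G →* Q),
    Function.Surjective φ ∧ φ g ≠ 1 ∧ k = Nat.card Q}

/-- The function `F_{G,S}(n)`: the largest depth of a nontrivial element of word length
at most `n`. For finite `S` only finitely many elements are involved, so the supremum is a maximum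
whenever there is such an element. -/
noncomputable def residualGrowth {G : Type u} [Group G] (S : Set G) (n : ℕ) : ℕ∞ :=
  sSup {d : ℕ∞ | ∃ g : G, g ≠ 1 ∧ wordLength S g ≤ n ∧ d = depth g}

/-- `F_G ≈ f`, where `F_G` is formed with respect to any finite generating set of `G`. -/
def ResidualGrowthEquiv (G : Type u) [Group G] (f : ℕ → ℝ≥0∞) : Prop :=
  ∀ S : Set G, S.Finite → Subgroup.closure S = ⊤ →
    AsympEquiv (fun n => ((residualGrowth S n : ℕ∞) : ℝ≥0∞)) f

/-! ### Hirsch length and filiform groups -/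

/-- A finite subnormal series `1 = H 0 ⊴ H 1 ⊴ ⋯ ⊴ H length = G` with cyclic factors. -/
structure PolycyclicSeries (G : Type u) [Group G] where
  length : ℕ
  H : ℕ → Subgroup G
  bot : H 0 = ⊥
  top : H length = ⊤
  le : ∀ i < length, H i ≤ H (i + 1)
  factor : ∀ i < length, ∃ _ : ((H i).subgroupOf (H (i + 1))).Normal,
    IsCyclic (H (i + 1) ⧸ (H i).subgroupOf (H (i + 1)))

open scoped Classical in
/-- The number of infinite factors of a polycyclic series. -/
noncomputable def PolycyclicSeries.infiniteFactors {G : Type u} [Group G]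
    (P : PolycyclicSeries G) : ℕ :=
  ((Finset.range P.length).filter
    fun i => Infinite (P.H (i + 1) ⧸ (P.H i).subgroupOf (P.H (i + 1)))).card

/-- The Hirsch length of a polycyclic group: the number of infinite factors of a polycyclic series.
This number is the same for all polycyclic series of `G`, so the infimum picks
the common value. (The value is `0` if `G` is not polycyclic.) -/
noncomputable def hirschLength (G : Type u) [Group G] : ℕ :=
  sInf {k : ℕ | ∃ P : PolycyclicSeries G, P.infiniteFactors = k}

/-- A filiform nilpotent group: a torsion-free finitely generated nilpotent group of
Hirsch length `h ≥ 3` and step length `h - 1`. -/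
structure IsFiliform (N : Type u) [Group N] : Prop where
  fg : Group.FG N
  nilpotent : Group.IsNilpotent N
  torsionFree : ∀ g : N, IsOfFinOrder g → g = 1
  three_le : 3 ≤ hirschLength N
  step : Group.nilpotencyClass N + 1 = hirschLength N

/-! ### The Heisenberg group -/

/-- The `3`-dimensional integral Heisenberg group: upper triangular integral `3 × 3` matrices
with all diagonal entries equal to `1`. -/
def heisenbergGroup : Subgroup (Matrix.SpecialLinearGroup (Fin 3) ℤ) where
  carrier := {A | (∀ i, A.1 i i = 1) ∧ ∀ i j, j < i → A.1 i j = 0}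
  one_mem' := by
    refine ⟨fun i => by simp, fun i j hij => by simp [hij.ne']⟩
  mul_mem' := by
    rintro A B ⟨hA, hA'⟩ ⟨hB, hB'⟩
    have a10 := hA' 1 0 (by decide)
    have a20 := hA' 2 0 (by decide)
    have a21 := hA' 2 1 (by decide)
    have b10 := hB' 1 0 (by decide)
    have b20 := hB' 2 0 (by decide)
    have b21 := hB' 2 1 (by decide)
    constructor
    · intro i
      fin_cases i <;>
        simp [Matrix.mul_apply, Fin.sum_univ_three, hA, hB, a10, a20, a21, b10, b20, b21]
    · intro i j hij
      fin_cases i <;> fin_cases j <;> first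
        | exact absurd hij (by decide)
        | simp [Matrix.mul_apply, Fin.sum_univ_three, hA, hB, a10, a20, a21, b10, b20, b21]
  inv_mem' := by
    rintro A ⟨hA, hA'⟩
    have a10 := hA' 1 0 (by decide)
    have a20 := hA' 2 0 (by decide)
    have a21 := hA' 2 1 (by decide)
    constructor
    · intro i
      fin_cases i <;>
        simp [Matrix.SpecialLinearGroup.coe_inv, Matrix.adjugate_fin_three, hA, a10, a20, a21]
    · intro i j hij
      fin_cases i <;> fin_cases j <;> first
        | exact absurd hij (by decide)
        | simp [Matrix.SpecialLinearGroup.coe_inv, Matrix.adjugate_fin_three, hA, a10, a20, a21]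

/-! The upper bound holds for every torsion-free nilpotent group with a polycyclic series, with h
its number of infinite factors. Finitely many integer-valued polynomial functions separate 1 from
all other elements (`PolycyclicSeries.hasSeparatingPolys`). They grow polynomially in word length,
and modulo a prime p above their degree they are constant on the normal closure of the p-th powers,
by Newton's difference formula. For g ≠ 1 of length at most n some f g - f 1 is a nonzero integer of
polynomial size, so Chebyshev's estimate yields a prime p = O(log 2n) not dividing it
(`exists_prime_not_dvd`). Then g survives in the quotient by the p-th powers, which has order
O(p^h), as each infinite cyclic factor shrinks to order at most p
(`PolycyclicSeries.card_le_of_exponent`).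

The lower bound (log n)^(s+1) depends only on the class s ≥ 2. Take a nontrivial left-normed
commutator w with s entries and L = lcm(1, …, m), where m is a small multiple of log n, so that L ≤
n and w^L has length O(n). If w^L survives in a finite quotient Q, the image of w has order k > m.
Every lower central factor of Q up to the s-th then has order at least k, and the abelianization
contributes k twice, so |Q| ≥ k^(s+1) (`pow_orderOf_leftNormed_le_card`). Filiform means h = s + 1,
so the two bounds meet. -/

open scoped commutatorElement

/-! ### Polynomial functions on groups -/

/-- The left difference `x ↦ f (g * x) - f x`. -/
def leftDiff {G : Type*} [Group G] (g : G) (f : G → ℤ) : G → ℤ := fun x => f (g * x) - f x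

/-- `IsPolyLT d f`: all `d`-fold left differences of `f` vanish, that is, `f` is a polynomial
function of degree less than `d`. -/
def IsPolyLT {G : Type*} [Group G] : ℕ → (G → ℤ) → Prop
  | 0, f => f = 0
  | d + 1, f => ∀ g, IsPolyLT d (leftDiff g f)

section Poly

variable {G : Type*} [Group G]

theorem leftDiff_zero (g : G) : leftDiff g 0 = 0 := by
  ext x; simp [leftDiff]

theorem leftDiff_one (f : G → ℤ) : leftDiff 1 f = 0 := by
  ext x; simp [leftDiff]

theorem IsPolyLT.zero (d : ℕ) : IsPolyLT d (0 : G → ℤ) := by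
  induction d with
  | zero => rfl
  | succ d ih => intro g; rw [leftDiff_zero]; exact ih

theorem IsPolyLT.succ {d : ℕ} {f : G → ℤ} (h : IsPolyLT d f) : IsPolyLT (d + 1) f := by
  induction d generalizing f with
  | zero => obtain rfl : f = 0 := h; exact IsPolyLT.zero _
  | succ d ih => exact fun g => ih (h g)

theorem IsPolyLT.mono {d e : ℕ} (hde : d ≤ e) {f : G → ℤ} (h : IsPolyLT d f) : IsPolyLT e f := by
  induction hde with
  | refl => exact h
  | step _ ih => exact ih.succ

theorem IsPolyLT.comp {H : Type*} [Group H] (ψ : H →* G) {d : ℕ} {f : G → ℤ} (h : IsPolyLT d f) :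
    IsPolyLT d (f ∘ ψ) := by
  induction d generalizing f with
  | zero => obtain rfl : f = 0 := h; rfl
  | succ d ih =>
    intro g
    have : leftDiff g (f ∘ ψ) = leftDiff (ψ g) f ∘ ψ := by ext x; simp [leftDiff]
    rw [this]
    exact ih (h (ψ g))

theorem IsPolyLT.iterate_leftDiff {d : ℕ} {f : G → ℤ} (h : IsPolyLT d f) (g : G) :
    (leftDiff g)^[d] f = 0 := by
  induction d generalizing f with
  | zero => exact h
  | succ d ih => rw [Function.iterate_succ_apply]; exact ih (h g)

/-- A function of weight less than `D` with respect to the filtration `M`: differences along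
`M i` lower the weight by `i + 1`. -/
def WeightLT (M : ℕ → Subgroup G) : ℕ → (G → ℤ) → Prop
  | 0, f => f = 0
  | D + 1, f => ∀ i, ∀ m ∈ M i, WeightLT M (D - i) (leftDiff m f)
termination_by D => D
decreasing_by omega

variable {M : ℕ → Subgroup G}

theorem weightLT_zero_iff {f : G → ℤ} : WeightLT M 0 f ↔ f = 0 := by
  rw [WeightLT]

theorem weightLT_succ_iff {D : ℕ} {f : G → ℤ} :
    WeightLT M (D + 1) f ↔ ∀ i, ∀ m ∈ M i, WeightLT M (D - i) (leftDiff m f) := by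
  rw [WeightLT]

theorem WeightLT.zero (D : ℕ) : WeightLT M D 0 := by
  induction D using Nat.strong_induction_on with
  | _ D ih =>
    cases D with
    | zero => exact weightLT_zero_iff.2 rfl
    | succ D =>
      refine weightLT_succ_iff.2 fun i m _ => ?_
      rw [leftDiff_zero]
      exact ih _ (by omega)

theorem WeightLT.add {D : ℕ} {f g : G → ℤ} (hf : WeightLT M D f) (hg : WeightLT M D g) :
    WeightLT M D (f + g) := by
  induction D using Nat.strong_induction_on generalizing f g with
  | _ D ih =>
    cases D with
    | zero =>
      rw [weightLT_zero_iff] at *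
      simp [hf, hg]
    | succ D =>
      rw [weightLT_succ_iff] at *
      intro i m hm
      have : leftDiff m (f + g) = leftDiff m f + leftDiff m g := by
        ext x; simp only [leftDiff, Pi.add_apply]; ring
      rw [this]
      exact ih _ (by omega) (hf i m hm) (hg i m hm)

theorem WeightLT.neg {D : ℕ} {f : G → ℤ} (hf : WeightLT M D f) : WeightLT M D (-f) := by
  induction D using Nat.strong_induction_on generalizing f with
  | _ D ih =>
    cases D with
    | zero =>
      rw [weightLT_zero_iff] at *
      simp [hf]
    | succ D =>
      rw [weightLT_succ_iff] at *
      intro i m hm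
      have : leftDiff m (-f) = -leftDiff m f := by
        ext x; simp only [leftDiff, Pi.neg_apply]; ring
      rw [this]
      exact ih _ (by omega) (hf i m hm)

theorem WeightLT.mono {D E : ℕ} (hDE : D ≤ E) {f : G → ℤ} (hf : WeightLT M D f) :
    WeightLT M E f := by
  induction E using Nat.strong_induction_on generalizing D f with
  | _ E ih =>
    cases D with
    | zero => rw [weightLT_zero_iff.1 hf]; exact WeightLT.zero _
    | succ D =>
      cases E with
      | zero => omega
      | succ E =>
        rw [weightLT_succ_iff] at *
        exact fun i m hm => ih _ (by omega) (D := D - i) (by omega) (hf i m hm)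

theorem WeightLT.translate (hM : ∀ i, (M i).Normal) {D : ℕ} {f : G → ℤ} (hf : WeightLT M D f)
    (g : G) : WeightLT M D (fun x => f (g * x)) := by
  induction D using Nat.strong_induction_on generalizing f with
  | _ D ih =>
    cases D with
    | zero =>
      rw [weightLT_zero_iff] at *
      simp [hf]; rfl
    | succ D =>
      rw [weightLT_succ_iff] at *
      intro i m hm
      have : leftDiff m (fun x => f (g * x)) = fun x => leftDiff (g * m * g⁻¹) f (g * x) := by
        ext x; simp only [leftDiff]; congr 2; group
      rw [this]
      exact ih _ (by omega) (hf i _ ((hM i).conj_mem m hm g))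

end Poly

/-! ### Extending polynomial functions from a normal subgroup with cyclic complement -/

section Extension

variable {G : Type*} [Group G]

/-- The trace on a subgroup of the lower central series of the whole group. -/
def relativeCentral (M : Subgroup G) (i : ℕ) : Subgroup G :=
  M ⊓ (⊤ : Subgroup G).lowerCentralSeries i

theorem relativeCentral_normal (M : Subgroup G) [M.Normal] (i : ℕ) :
    (relativeCentral M i).Normal := by
  unfold relativeCentral; infer_instance

variable {M : Subgroup G} [M.Normal] {t : G}

/-- Moving a difference along t past one along m costs only a difference along ⁅t, m⁆, which lies
one step deeper in the filtration. So a difference along t also lowers the weight, by one, although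
t need not lie in M. -/
theorem WeightLT.leftDiff_complement (hdec : ∀ y : G, ∃ m ∈ M, ∃ k : ℤ, y = m * t ^ k)
    {D : ℕ} {f : G → ℤ} (ht : ∀ x, f (x * t) = f x)
    (hf : WeightLT (relativeCentral M) (D + 1) f) :
    WeightLT (relativeCentral M) D (leftDiff t f) := by
  induction D using Nat.strong_induction_on generalizing f with
  | _ D ih =>
    cases D with
    | zero =>
      -- Weight less than 1 means invariance under M; together with invariance under t this makes f
      -- constant.
      have hM : ∀ m ∈ M, ∀ x, f (m * x) = f x := by
        intro m hm x
        have h0 := weightLT_succ_iff.1 hf 0 m (by simp [relativeCentral, hm])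
        have := congrFun (weightLT_zero_iff.1 h0) x
        simp only [leftDiff, Pi.zero_apply] at this
        omega
      have htk : ∀ k : ℤ, ∀ x, f (x * t ^ k) = f x := by
        intro k
        induction k with
        | zero => simp
        | succ k ihk => intro x; rw [zpow_add_one, ← mul_assoc, ht, ihk]
        | pred k ihk =>
          intro x
          rw [← ht, mul_assoc, ← zpow_add_one, sub_add_cancel, ihk]
      have hc : ∀ y, f y = f 1 := by
        intro y
        obtain ⟨m, hm, k, rfl⟩ := hdec y
        rw [htk, ← mul_one m, hM m hm]
      rw [weightLT_zero_iff]
      ext x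
      simp [leftDiff, hc (t * x), hc x]
    | succ D =>
      rw [weightLT_succ_iff] at *
      intro i m hm
      have hu : ⁅t, m⁆ ∈ relativeCentral M (i + 1) := by
        refine ⟨?_, ?_⟩
        · exact M.mul_mem (‹M.Normal›.conj_mem m hm.1 t) (M.inv_mem hm.1)
        · rw [← commutatorElement_inv]
          exact Subgroup.inv_mem _
            (Subgroup.commutator_mem_commutator hm.2 (Subgroup.mem_top t))
      have key : leftDiff m (leftDiff t f) =
          leftDiff t (leftDiff m f) + fun x => leftDiff ⁅t, m⁆ f ((m * t) * x) := by
        ext x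
        simp only [leftDiff, Pi.add_apply]
        have e1 : t * (m * x) = ⁅t, m⁆ * (m * t * x) := by
          rw [commutatorElement_def]; group
        rw [e1, ← mul_assoc m t x]
        ring
      rw [key]
      refine WeightLT.add ?_ ?_
      · have h1 := hf i m hm
        by_cases hiD : i ≤ D
        · rw [show D + 1 - i = D - i + 1 by omega] at h1
          refine ih (D - i) (by omega) ?_ h1
          intro x
          simp only [leftDiff]
          rw [← mul_assoc, ht, ht]
        · rw [show D + 1 - i = 0 by omega, weightLT_zero_iff] at h1
          rw [h1, leftDiff_zero]
          exact WeightLT.zero _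
      · have h2 := hf (i + 1) _ hu
        rw [show D + 1 - (i + 1) = D - i by omega] at h2
        exact h2.translate (relativeCentral_normal M) _

/-- The elements whose difference lowers the weight form a subgroup, by the cocycle identity for
differences. It contains M and t, hence everything. -/
theorem WeightLT.isPolyLT (hdec : ∀ y : G, ∃ m ∈ M, ∃ k : ℤ, y = m * t ^ k)
    {D : ℕ} {f : G → ℤ} (ht : ∀ x, f (x * t) = f x)
    (hf : WeightLT (relativeCentral M) D f) : IsPolyLT D f := by
  induction D generalizing f with
  | zero => exact weightLT_zero_iff.1 hf
  | succ D ih =>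
    intro g
    have hn := relativeCentral_normal M
    let A : Subgroup G :=
      { carrier := {g | WeightLT (relativeCentral M) D (leftDiff g f)}
        one_mem' := by
          simp only [Set.mem_ofPred_eq]
          rw [leftDiff_one]
          exact WeightLT.zero _
        mul_mem' := by
          intro a b ha hb
          have : leftDiff (a * b) f = (fun x => leftDiff a f (b * x)) + leftDiff b f := by
            ext x; simp [leftDiff, mul_assoc]
          simp only [Set.mem_ofPred_eq]
          rw [this]
          exact (ha.translate hn b).add hb
        inv_mem' := by
          intro a ha
          have : leftDiff a⁻¹ f = -(fun x => leftDiff a f (a⁻¹ * x)) := by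
            ext x; simp [leftDiff]
          simp only [Set.mem_ofPred_eq]
          rw [this]
          exact (ha.translate hn a⁻¹).neg }
    have hA : g ∈ A := by
      obtain ⟨m, hm, k, rfl⟩ := hdec g
      refine A.mul_mem ?_ (A.zpow_mem ?_ k)
      · exact weightLT_succ_iff.1 hf 0 m (by simp [relativeCentral, hm])
      · exact hf.leftDiff_complement hdec ht
    refine ih ?_ hA
    intro x
    simp only [leftDiff]
    rw [← mul_assoc, ht, ht]

end Extension

/-- Only the filtration steps i ≤ c are nontrivial, so a single difference is charged at most c + 1
units of weight; granting c + 1 units per degree suffices. -/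
theorem weightLT_of_isPolyLT_restrict {G : Type*} [Group G] {M : Subgroup G} {t : G}
    (hdec : ∀ y : G, ∃ m ∈ M, ∃ k : ℤ, y = m * t ^ k)
    {c : ℕ} (hc : (⊤ : Subgroup G).lowerCentralSeries (c + 1) = ⊥) {d : ℕ} {f : G → ℤ}
    (ht : ∀ x, ∀ k : ℤ, f (x * t ^ k) = f x) (hf : IsPolyLT d (f ∘ M.subtype)) :
    WeightLT (relativeCentral M) ((c + 1) * d) f := by
  induction d generalizing f with
  | zero =>
    rw [Nat.mul_zero, weightLT_zero_iff]
    ext y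
    obtain ⟨m, hm, k, rfl⟩ := hdec y
    rw [ht]
    exact congrFun hf ⟨m, hm⟩
  | succ d ih =>
    rw [show (c + 1) * (d + 1) = (c + 1) * d + c + 1 by ring, weightLT_succ_iff]
    intro i m hm
    by_cases hi : i ≤ c
    · refine WeightLT.mono (D := (c + 1) * d) (by omega) (ih ?_ ?_)
      · intro x k
        simp only [leftDiff]
        rw [← mul_assoc, ht, ht]
      · exact hf ⟨m, hm.1⟩
    · have : m ∈ (⊤ : Subgroup G).lowerCentralSeries (c + 1) :=
        Subgroup.lowerCentralSeries_antitone _ (by omega) hm.2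
      rw [hc, Subgroup.mem_bot] at this
      rw [this, leftDiff_one]
      exact WeightLT.zero _

/-- A finite family of polynomial functions tells the identity from all other elements. -/
def HasSeparatingPolys (G : Type*) [Group G] : Prop :=
  ∃ F : Set (G → ℤ), F.Finite ∧ (∀ f ∈ F, ∃ d, IsPolyLT d f) ∧
    ∀ g : G, (∀ f ∈ F, f g = f 1) → g = 1

theorem HasSeparatingPolys.of_injective {G H : Type*} [Group G] [Group H] (ψ : H →* G)
    (hψ : Function.Injective ψ) (h : HasSeparatingPolys G) : HasSeparatingPolys H := by
  obtain ⟨F, hfin, hpoly, hsep⟩ := h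
  refine ⟨(fun f => f ∘ ψ) '' F, hfin.image _, ?_, ?_⟩
  · rintro _ ⟨f, hf, rfl⟩
    obtain ⟨d, hd⟩ := hpoly f hf
    exact ⟨d, hd.comp ψ⟩
  · intro g hg
    apply hψ
    rw [map_one]
    apply hsep
    intro f hf
    simpa using hg _ ⟨f, hf, rfl⟩

theorem isPolyLT_of_hom {G : Type*} [Group G] (φ : G →* Multiplicative ℤ) :
    IsPolyLT 2 (fun g => (φ g).toAdd) := by
  intro a b
  ext x
  simp [leftDiff]

/-- Choose t whose image generates the range of φ. Functions on the kernel extend to G by ignoring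
the power of t, and stay polynomial by the weight argument; φ itself detects elements outside the
kernel. -/
theorem HasSeparatingPolys.of_ker {G : Type*} [Group G] [Group.IsNilpotent G]
    (φ : G →* Multiplicative ℤ) (h : HasSeparatingPolys φ.ker) : HasSeparatingPolys G := by
  obtain ⟨⟨_, t, rfl⟩, hτ⟩ := IsCyclic.exists_generator (α := φ.range)
  have hpow : ∀ y, ∃ k : ℤ, φ y = φ t ^ k := by
    intro y
    obtain ⟨k, hk⟩ := Subgroup.mem_zpowers_iff.1 (hτ ⟨φ y, y, rfl⟩)
    exact ⟨k, by simpa using (congrArg Subtype.val hk).symm⟩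
  by_cases h1 : φ t = 1
  · have hk : φ.ker = ⊤ := by
      rw [eq_top_iff]
      intro y _
      obtain ⟨k, hk⟩ := hpow y
      simp [MonoidHom.mem_ker, hk, h1]
    exact h.of_injective ((MonoidHom.id G).codRestrict φ.ker (by simp [hk]))
      (fun a b hab => by simpa using congrArg Subtype.val hab)
  · choose k hk using hpow
    have huniq : ∀ y (j : ℤ), φ y = φ t ^ j → k y = j := by
      intro y j hj
      rw [hk y] at hj
      have h2 := congrArg Multiplicative.toAdd hj
      simp only [toAdd_zpow, smul_eq_mul] at h2
      exact mul_right_cancel₀ (fun h0 => h1 (toAdd_eq_zero.1 h0)) h2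
    have hmem : ∀ y, y * t ^ (-k y) ∈ φ.ker := by
      intro y
      rw [MonoidHom.mem_ker, map_mul, map_zpow, zpow_neg, hk y, mul_inv_cancel]
    have hkt : ∀ y (j : ℤ), k (y * t ^ j) = k y + j := by
      intro y j
      apply huniq
      rw [map_mul, map_zpow, zpow_add, hk y]
    have hdec : ∀ y : G, ∃ m ∈ φ.ker, ∃ k : ℤ, y = m * t ^ k :=
      fun y => ⟨_, hmem y, k y, by group⟩
    let ext : (φ.ker → ℤ) → G → ℤ := fun f y => f ⟨_, hmem y⟩
    have ext_t : ∀ f x (j : ℤ), ext f (x * t ^ j) = ext f x := by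
      intro f x j
      simp only [ext]
      congr 2
      rw [hkt]
      group
    have ext_ker : ∀ f, ext f ∘ φ.ker.subtype = f := by
      intro f
      funext ⟨m, hm⟩
      have : k m = 0 := huniq m 0 (by rw [zpow_zero]; exact hm)
      simp only [ext, Function.comp_apply, Subgroup.subtype_apply]
      congr 2
      simp [this]
    obtain ⟨F, hfin, hpoly, hsep⟩ := h
    obtain ⟨c, hc⟩ := Subgroup.nilpotent_iff_lowerCentralSeries.1 ‹Group.IsNilpotent G›
    have hc' : (⊤ : Subgroup G).lowerCentralSeries (c + 1) = ⊥ :=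
      le_bot_iff.1 (hc ▸ Subgroup.lowerCentralSeries_antitone _ (Nat.le_succ c))
    refine ⟨insert (fun g => (φ g).toAdd) (ext '' F), (hfin.image _).insert _, ?_, ?_⟩
    · rintro _ (rfl | ⟨f, hf, rfl⟩)
      · exact ⟨2, isPolyLT_of_hom φ⟩
      · obtain ⟨d, hd⟩ := hpoly f hf
        refine ⟨(c + 1) * d, WeightLT.isPolyLT hdec (fun x => by simpa using ext_t f x 1) ?_⟩
        exact weightLT_of_isPolyLT_restrict hdec hc' (ext_t f) (by rwa [ext_ker])
    · intro g hg
      have hgker : g ∈ φ.ker := by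
        have := hg _ (Set.mem_insert _ _)
        simpa [MonoidHom.mem_ker] using this
      have : (⟨g, hgker⟩ : φ.ker) = 1 := by
        apply hsep
        intro f hf
        have := hg _ (Set.mem_insert_of_mem _ ⟨f, hf, rfl⟩)
        rw [← congrFun (ext_ker f) ⟨g, hgker⟩, ← congrFun (ext_ker f) 1]
        exact this
      exact congrArg Subtype.val this

/-! ### Separating polynomial functions on torsion-free nilpotent groups -/

theorem HasSeparatingPolys.of_ker_pi {G : Type*} [Group G] [Group.IsNilpotent G] (r : ℕ)
    (π : G →* Multiplicative (Fin r → ℤ)) (h : HasSeparatingPolys π.ker) :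
    HasSeparatingPolys G := by
  induction r generalizing G with
  | zero =>
    exact h.of_injective
      ((MonoidHom.id G).codRestrict π.ker (fun x => by
        rw [MonoidHom.mem_ker]; exact Subsingleton.elim _ _))
      (fun a b hab => by simpa using congrArg Subtype.val hab)
  | succ r ih =>
    let hd : (Fin (r + 1) → ℤ) →+ ℤ := Pi.evalAddMonoidHom _ 0
    let tl : (Fin (r + 1) → ℤ) →+ (Fin r → ℤ) :=
      { toFun := Fin.tail, map_zero' := rfl, map_add' := fun _ _ => rfl }
    refine HasSeparatingPolys.of_ker ((AddMonoidHom.toMultiplicative hd).comp π) ?_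
    refine ih (((AddMonoidHom.toMultiplicative tl).comp π).comp (Subgroup.subtype _)) ?_
    refine h.of_injective (((Subgroup.subtype _).comp (Subgroup.subtype _)).codRestrict _ ?_) ?_
    · rintro ⟨⟨x, hx⟩, hx'⟩
      rw [MonoidHom.mem_ker] at *
      have h0 : (π x).toAdd 0 = 0 := congrArg Multiplicative.toAdd hx
      have h1 : Fin.tail (π x).toAdd = 0 := congrArg Multiplicative.toAdd hx'
      change π x = 1
      apply Multiplicative.toAdd.injective
      funext i
      refine Fin.cases h0 (fun i => congrFun h1 i) i
    · intro a b hab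
      have h2 : a.1.1 = b.1.1 := congrArg (fun z : π.ker => (z : G)) hab
      exact Subtype.ext (Subtype.ext h2)

theorem commutatorElement_pow_of_commute {G : Type*} [Group G] {a x : G}
    (h : ∀ g, Commute ⁅a, x⁆ g) (n : ℕ) : ⁅a ^ n, x⁆ = ⁅a, x⁆ ^ n := by
  induction n with
  | zero => simp
  | succ n ih =>
    have e : ⁅a ^ (n + 1), x⁆ = a * ⁅a ^ n, x⁆ * a⁻¹ * ⁅a, x⁆ := by
      simp only [commutatorElement_def, pow_succ']; group
    rw [e, ih, pow_succ, ((h a).pow_left n).symm.eq, mul_inv_cancel_right]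

/-- If `⁅a, x⁆` is central modulo `K`, then `⁅a ^ n, x⁆` and `⁅a, x⁆ ^ n` agree modulo `K`. -/
theorem commutatorElement_pow_mem_iff {G : Type*} [Group G] (K : Subgroup G) [K.Normal] {a x : G}
    (h : ∀ g, ⁅⁅a, x⁆, g⁆ ∈ K) (n : ℕ) : ⁅a ^ n, x⁆ ∈ K ↔ ⁅a, x⁆ ^ n ∈ K := by
  have h' : ∀ g : G ⧸ K, Commute ⁅QuotientGroup.mk' K a, QuotientGroup.mk' K x⁆ g := by
    intro g
    obtain ⟨g, rfl⟩ := QuotientGroup.mk'_surjective K g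
    rw [← map_commutatorElement, ← commutatorElement_eq_one_iff_commute, ← map_commutatorElement]
    exact (QuotientGroup.eq_one_iff _).2 (h g)
  rw [← QuotientGroup.eq_one_iff, ← QuotientGroup.eq_one_iff (N := K) (⁅a, x⁆ ^ n)]
  change QuotientGroup.mk' K _ = 1 ↔ QuotientGroup.mk' K _ = 1
  rw [map_commutatorElement, map_pow, commutatorElement_pow_of_commute h', map_pow,
    map_commutatorElement]

/-- The upper central factors of a torsion-free group are torsion-free: taking commutators with y
turns the question about x into the same question about ⁅x, y⁆ one level lower. -/
theorem mem_upperCentralSeries_of_pow_mem {G : Type*} [Group G]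
    (htf : ∀ g : G, IsOfFinOrder g → g = 1) {n : ℕ} (hn : 0 < n) (i : ℕ) {x : G}
    (hx : x ∈ Subgroup.upperCentralSeries G (i + 1))
    (hxn : x ^ n ∈ Subgroup.upperCentralSeries G i) : x ∈ Subgroup.upperCentralSeries G i := by
  induction i generalizing x with
  | zero =>
    rw [Subgroup.upperCentralSeries_zero, Subgroup.mem_bot] at *
    exact htf x (isOfFinOrder_iff_pow_eq_one.2 ⟨n, hn, hxn⟩)
  | succ i ih =>
    rw [Subgroup.mem_upperCentralSeries_succ_iff] at hx hxn ⊢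
    intro y
    refine ih (hx y) ?_
    rw [← commutatorElement_pow_mem_iff]
    · exact hxn y
    · exact fun g => Subgroup.mem_upperCentralSeries_succ_iff.1 (hx y) g

theorem exists_hom_pi_of_commGroup {A : Type*} [CommGroup A] [Group.FG A]
    (htf : ∀ a : A, IsOfFinOrder a → a = 1) :
    ∃ (r : ℕ) (π : A →* Multiplicative (Fin r → ℤ)), Function.Injective π := by
  have : Module.Finite ℤ (Additive A) := Module.Finite.iff_addGroup_fg.2 inferInstance
  have : IsAddTorsionFree (Additive A) := by
    rw [isAddTorsionFree_iff_not_isOfFinAddOrder]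
    intro a ha hfin
    exact ha (htf a.toMul (by rwa [← isOfFinAddOrder_ofMul_iff]))
  let b := Module.finBasis ℤ (Additive A)
  refine ⟨_, AddMonoidHom.toMultiplicativeRight b.equivFun.toLinearMap.toAddMonoidHom, ?_⟩
  intro x y hxy
  exact b.equivFun.injective hxy

/-- Along the series, each cyclic factor requires at most one new generator of the intersection with
K. -/
theorem PolycyclicSeries.fg_subgroup {G : Type u} [Group G] (P : PolycyclicSeries G)
    (K : Subgroup G) : K.FG := by
  have key : ∀ i ≤ P.length, (K ⊓ P.H i).FG := by
    intro i
    induction i with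
    | zero => intro _; rw [P.bot, inf_bot_eq]; exact Subgroup.FG.bot
    | succ i ih =>
      intro hi
      obtain ⟨hn, hc⟩ := P.factor i (by omega)
      let q : (K ⊓ P.H (i + 1) : Subgroup G) →* P.H (i + 1) ⧸ (P.H i).subgroupOf (P.H (i + 1)) :=
        (QuotientGroup.mk' _).comp (Subgroup.inclusion inf_le_right)
      obtain ⟨⟨_, t, rfl⟩, ht⟩ := IsCyclic.exists_generator (α := q.range)
      obtain ⟨S, hS⟩ := ih (by omega)
      have : K ⊓ P.H (i + 1) = (K ⊓ P.H i) ⊔ Subgroup.zpowers (t : G) := by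
        apply le_antisymm
        · intro x hx
          obtain ⟨k, hk⟩ := Subgroup.mem_zpowers_iff.1 (ht ⟨q ⟨x, hx⟩, ⟨x, hx⟩, rfl⟩)
          have hk' : q t ^ k = q ⟨x, hx⟩ := congrArg Subtype.val hk
          rw [← map_zpow, eq_comm, ← div_eq_one, ← map_div] at hk'
          have hmem := (QuotientGroup.eq_one_iff _).1 hk'
          rw [Subgroup.mem_subgroupOf] at hmem
          have h2 : x / (t : G) ^ k ∈ P.H i := by simpa using hmem
          have h3 : x / (t : G) ^ k ∈ K := K.div_mem hx.1 (K.zpow_mem t.2.1 k)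
          have := Subgroup.mul_mem_sup (show x / (t : G) ^ k ∈ K ⊓ P.H i from ⟨h3, h2⟩)
            (Subgroup.zpow_mem_zpowers (t : G) k)
          simpa using this
        · refine sup_le (inf_le_inf_left _ (P.le i (by omega))) ?_
          rw [Subgroup.zpowers_le]
          exact t.2
      rw [this]
      exact Subgroup.FG.sup ⟨S, hS⟩ ⟨{(t : G)}, by simp [Subgroup.zpowers_eq_closure]⟩
  have := key P.length le_rfl
  rwa [P.top, inf_top_eq] at this

/-- Climb the upper central series: each factor is finitely generated, abelian and torsion-free,
hence embeds in some ℤ^r, and `HasSeparatingPolys.of_ker_pi` lifts the functions one level. -/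
theorem PolycyclicSeries.hasSeparatingPolys {G : Type u} [Group G] [Group.IsNilpotent G]
    (P : PolycyclicSeries G) (htf : ∀ g : G, IsOfFinOrder g → g = 1) : HasSeparatingPolys G := by
  have key : ∀ i, HasSeparatingPolys (Subgroup.upperCentralSeries G i) := by
    intro i
    induction i with
    | zero =>
      refine ⟨∅, Set.finite_empty, fun f hf => absurd hf (Set.notMem_empty f), ?_⟩
      rintro ⟨g, hg⟩ _
      exact Subtype.ext (by simpa using hg)
    | succ i ih =>
      let Z := Subgroup.upperCentralSeries G (i + 1)
      let K := (Subgroup.upperCentralSeries G i).subgroupOf Z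
      have : Group.FG Z := (Group.fg_iff_subgroup_fg _).2 (P.fg_subgroup _)
      let A : CommGroup (Z ⧸ K) :=
        { (inferInstance : Group (Z ⧸ K)) with
          mul_comm := by
            intro a b
            obtain ⟨a, rfl⟩ := QuotientGroup.mk'_surjective K a
            obtain ⟨b, rfl⟩ := QuotientGroup.mk'_surjective K b
            change Commute _ _
            rw [← commutatorElement_eq_one_iff_commute, ← map_commutatorElement]
            exact (QuotientGroup.eq_one_iff _).2
              (Subgroup.mem_upperCentralSeries_succ_iff.1 a.2 b) }
      have hfg : Group.FG (Z ⧸ K) := QuotientGroup.fg K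
      obtain ⟨r, π, hπ⟩ := exists_hom_pi_of_commGroup (A := Z ⧸ K) (by
        intro a ha
        obtain ⟨a, rfl⟩ := QuotientGroup.mk'_surjective K a
        obtain ⟨n, hn, han⟩ := isOfFinOrder_iff_pow_eq_one.1 ha
        rw [← map_pow] at han
        have han' : a ^ n ∈ K := (QuotientGroup.eq_one_iff _).1 han
        exact (QuotientGroup.eq_one_iff _).2 (mem_upperCentralSeries_of_pow_mem htf hn i a.2 han'))
      refine HasSeparatingPolys.of_ker_pi r (π.comp (QuotientGroup.mk' K)) ?_
      refine ih.of_injective ((Z.subtype.comp (Subgroup.subtype _)).codRestrict _ ?_) ?_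
      · rintro ⟨x, hx⟩
        rw [MonoidHom.mem_ker, MonoidHom.comp_apply, ← map_one π] at hx
        have hxK : x ∈ K := (QuotientGroup.eq_one_iff _).1 (hπ hx)
        exact hxK
      · intro a b hab
        have h2 : a.1.1 = b.1.1 :=
          congrArg (fun z : Subgroup.upperCentralSeries G i => (z : G)) hab
        exact Subtype.ext (Subtype.ext h2)
  obtain ⟨n, hn⟩ := Group.IsNilpotent.nilpotent G
  refine (key n).of_injective ((MonoidHom.id G).codRestrict _ (by simp [hn])) ?_
  exact fun a b hab => by simpa using congrArg Subtype.val hab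

/-! ### Quotients of prime exponent -/

/-- In Newton's expansion of j ↦ f (g ^ j * x) at j = p, the p-th difference vanishes as d ≤ p, and
the binomials strictly between 0 and p are divisible by p. -/
theorem IsPolyLT.prime_dvd_pow_mul_sub {G : Type*} [Group G] {d : ℕ} {f : G → ℤ}
    (hf : IsPolyLT d f) {p : ℕ} (hp : p.Prime) (hd : d ≤ p) (g x : G) :
    (p : ℤ) ∣ f (g ^ p * x) - f x := by
  have hit : ∀ k : ℕ, (fwdDiff (1 : ℕ))^[k] (fun j => f (g ^ j * x)) =
      fun j => (leftDiff g)^[k] f (g ^ j * x) := by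
    intro k
    induction k with
    | zero => rfl
    | succ k ih =>
      rw [Function.iterate_succ_apply', ih]
      ext j
      rw [Function.iterate_succ_apply']
      simp only [fwdDiff, leftDiff]
      rw [pow_succ', mul_assoc]
  have h := shift_eq_sum_fwdDiff_iter (1 : ℕ) (fun j => f (g ^ j * x)) p 0
  simp only [hit, smul_eq_mul, mul_one, zero_add, pow_zero, one_mul] at h
  obtain ⟨q, rfl⟩ := Nat.exists_eq_succ_of_ne_zero hp.ne_zero
  rw [h, Finset.sum_range_succ, (hf.mono hd).iterate_leftDiff g, Finset.sum_range_succ']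
  simp only [Function.iterate_zero, id_eq, Nat.choose_zero_right, one_smul, Pi.zero_apply,
    smul_zero, add_zero, add_sub_cancel_right]
  refine Finset.dvd_sum fun k hk => ?_
  rw [nsmul_eq_mul]
  refine Dvd.dvd.mul_right (Int.natCast_dvd_natCast.2 (hp.dvd_choose_self (by omega) ?_)) _
  have := Finset.mem_range.1 hk
  omega

/-- The normal subgroup generated by all `p`-th powers. -/
def powSubgroup (G : Type*) [Group G] (p : ℕ) : Subgroup G :=
  Subgroup.normalClosure (Set.range fun g : G => g ^ p)

instance (G : Type*) [Group G] (p : ℕ) : (powSubgroup G p).Normal :=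
  Subgroup.normalClosure_normal

theorem pow_eq_one_of_quotient_powSubgroup {G : Type*} [Group G] (p : ℕ) (q : G ⧸ powSubgroup G p) :
    q ^ p = 1 := by
  obtain ⟨g, rfl⟩ := QuotientGroup.mk'_surjective _ q
  rw [← map_pow]
  exact (QuotientGroup.eq_one_iff _).2 (Subgroup.subset_normalClosure ⟨g, rfl⟩)

theorem IsPolyLT.prime_dvd_sub_of_mem_powSubgroup {G : Type*} [Group G] {d : ℕ} {f : G → ℤ}
    (hf : IsPolyLT d f) {p : ℕ} (hp : p.Prime) (hd : d ≤ p) {u : G} (hu : u ∈ powSubgroup G p) :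
    (p : ℤ) ∣ f u - f 1 := by
  -- Requiring the congruence at every x, not just at 1, makes the condition a subgroup.
  let A : Subgroup G :=
    { carrier := {u | ∀ x, (p : ℤ) ∣ f (u * x) - f x}
      one_mem' := by intro x; simp
      mul_mem' := by
        intro a b ha hb x
        have := dvd_add (ha (b * x)) (hb x)
        rwa [sub_add_sub_cancel, ← mul_assoc] at this
      inv_mem' := by
        intro a ha x
        have := ha (a⁻¹ * x)
        rw [mul_inv_cancel_left] at this
        rwa [dvd_sub_comm] }
  have : powSubgroup G p ≤ A := by
    refine (Subgroup.closure_le _).2 ?_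
    intro y hy
    obtain ⟨_, ⟨g, rfl⟩, hc⟩ := Group.mem_conjugatesOfSet_iff.1 hy
    obtain ⟨c, rfl⟩ := isConj_iff.1 hc
    intro x
    simp only
    rw [← conj_pow]
    exact hf.prime_dvd_pow_mul_sub hp hd _ x
  simpa using this hu 1

/-! ### Growth of polynomial functions in word length -/

theorem IsPolyLT.abs_prod_le {G : Type*} [Group G] {T : Set G} (hT : T.Finite) {d : ℕ}
    {f : G → ℤ} (hf : IsPolyLT d f) :
    ∃ A : ℕ, ∀ l : List G, (∀ s ∈ l, s ∈ T) → |f l.prod| ≤ A * ((l.length : ℤ) + 1) ^ d := by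
  induction d generalizing f with
  | zero =>
    obtain rfl : f = 0 := hf
    exact ⟨0, by simp⟩
  | succ d ih =>
    choose A hA using fun g => ih (hf g)
    set B : ℕ := ∑ s ∈ hT.toFinset, A s with hB
    -- Removing the first letter s changes f by a difference of lower degree; these changes are
    -- summed over the word.
    have hstep : ∀ l : List G, (∀ s ∈ l, s ∈ T) →
        |f l.prod| ≤ |f 1| + B * l.length * ((l.length : ℤ) + 1) ^ d := by
      intro l
      induction l with
      | nil => simp
      | cons s l ihl =>
        intro hl
        have hl' : ∀ s ∈ l, s ∈ T := fun s hs => hl s (List.mem_cons_of_mem _ hs)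
        have h1 := ihl hl'
        have h2 := hA s l hl'
        have h3 : (A s : ℤ) ≤ B := by
          have : A s ≤ B := Finset.single_le_sum (f := A) (fun _ _ => Nat.zero_le _)
            (hT.mem_toFinset.2 (hl s List.mem_cons_self))
          exact_mod_cast this
        have h4 : f (s :: l).prod = f l.prod + leftDiff s f l.prod := by
          simp [leftDiff]
        have h5 : (0 : ℤ) ≤ ((l.length : ℤ) + 1) ^ d := by positivity
        have h6 : ((l.length : ℤ) + 1) ^ d ≤ ((l.length : ℤ) + 1 + 1) ^ d := by gcongr; omega
        rw [h4, List.length_cons]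
        push_cast
        calc |f l.prod + leftDiff s f l.prod| ≤ |f l.prod| + |leftDiff s f l.prod| := abs_add_le _ _
          _ ≤ (|f 1| + B * l.length * ((l.length : ℤ) + 1) ^ d) + B * ((l.length : ℤ) + 1) ^ d := by
            gcongr
            exact h2.trans (by gcongr)
          _ = |f 1| + B * (l.length + 1) * ((l.length : ℤ) + 1) ^ d := by ring
          _ ≤ _ := by gcongr
    refine ⟨(f 1).natAbs + B, fun l hl => (hstep l hl).trans ?_⟩
    have h1 : (1 : ℤ) ≤ ((l.length : ℤ) + 1) ^ (d + 1) := one_le_pow₀ (by omega)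
    push_cast
    rw [add_mul]
    refine add_le_add (le_mul_of_one_le_right (abs_nonneg _) h1) ?_
    rw [pow_succ', ← mul_assoc]
    gcongr
    omega

/-! ### Orders of quotients of exponent p -/

/-- For an infinite factor `Nat.card` is 0, and the last clause is vacuous. -/
theorem PolycyclicSeries.exists_factor_generator {G : Type u} [Group G] (P : PolycyclicSeries G)
    {i : ℕ} (hi : i < P.length) :
    ∃ t ∈ P.H (i + 1), (∀ x ∈ P.H (i + 1), ∃ k : ℤ, x * t ^ (-k) ∈ P.H i) ∧
      t ^ Nat.card (P.H (i + 1) ⧸ (P.H i).subgroupOf (P.H (i + 1))) ∈ P.H i := by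
  obtain ⟨hn, hc⟩ := P.factor i hi
  obtain ⟨τ, hτ⟩ := IsCyclic.exists_generator
    (α := P.H (i + 1) ⧸ (P.H i).subgroupOf (P.H (i + 1)))
  obtain ⟨t, rfl⟩ := QuotientGroup.mk'_surjective _ τ
  refine ⟨t, t.2, ?_, ?_⟩
  · intro x hx
    obtain ⟨k, hk⟩ := Subgroup.mem_zpowers_iff.1 (hτ (QuotientGroup.mk' _ ⟨x, hx⟩))
    refine ⟨k, ?_⟩
    rw [← map_zpow, eq_comm, ← mul_inv_eq_one, ← map_inv, ← map_mul] at hk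
    have := (QuotientGroup.eq_one_iff _).1 hk
    rw [Subgroup.mem_subgroupOf] at this
    simpa using this
  · have h := pow_card_eq_one' (x := QuotientGroup.mk' ((P.H i).subgroupOf (P.H (i + 1))) t)
    rw [← map_pow] at h
    have := (QuotientGroup.eq_one_iff _).1 h
    rw [Subgroup.mem_subgroupOf] at this
    simpa using this

theorem Subgroup.finite_of_generator_mod {Q : Type*} [Group Q] {A B : Subgroup Q} [Finite A]
    {b : ℕ} (hb : 0 < b) {t : Q} (htb : t ^ b ∈ A)
    (h : ∀ x ∈ B, ∃ k : ℤ, x * t ^ (-k) ∈ A) : Finite B ∧ Nat.card B ≤ Nat.card A * b := by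
  have hx : ∀ x : B, ∃ y : A × Fin b, (x : Q) = y.1 * t ^ (y.2 : ℕ) := by
    intro ⟨x, hx⟩
    obtain ⟨k, hk⟩ := h x hx
    have hb' : (0 : ℤ) < b := by exact_mod_cast hb
    have h0 := Int.emod_nonneg k hb'.ne'
    have hlt := Int.emod_lt_of_pos k hb'
    refine ⟨⟨⟨x * t ^ (-k) * (t ^ b) ^ (k / b), A.mul_mem hk (A.zpow_mem htb _)⟩,
      ⟨(k % b).toNat, by omega⟩⟩, ?_⟩
    simp only
    have e : t ^ (k % b).toNat = t ^ (k % b) := by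
      rw [← zpow_natCast, Int.toNat_of_nonneg h0]
    rw [e, ← zpow_natCast, ← zpow_mul, mul_assoc, mul_assoc, ← zpow_add, ← zpow_add,
      Int.mul_ediv_add_emod]
    simp
  choose y hy using hx
  have hinj : Function.Injective y := by
    intro a c hac
    apply Subtype.ext
    rw [hy a, hy c, hac]
  refine ⟨Finite.of_injective y hinj, ?_⟩
  simpa using Nat.card_le_card_of_injective y hinj

theorem PolycyclicSeries.card_le_of_exponent {G : Type u} [Group G] (P : PolycyclicSeries G)
    {h : ℕ} (hP : P.infiniteFactors ≤ h) :
    ∃ B : ℕ, ∀ p : ℕ, 0 < p → ∀ (Q : Type u) [Group Q] (φ : G →* Q), Function.Surjective φ →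
      (∀ q : Q, q ^ p = 1) → Finite Q ∧ Nat.card Q ≤ B * p ^ h := by
  classical
  let F : ℕ → Type u := fun i => P.H (i + 1) ⧸ (P.H i).subgroupOf (P.H (i + 1))
  refine ⟨∏ i ∈ (Finset.range P.length).filter (fun i => ¬ Infinite (F i)), Nat.card (F i), ?_⟩
  intro p hp Q _ φ hφ hexp
  -- An infinite factor contributes at most the exponent p, a finite one at most its own order.
  let b : ℕ → ℕ := fun i => if Infinite (F i) then p else Nat.card (F i)
  have key : ∀ i ≤ P.length, Finite ((P.H i).map φ) ∧
      Nat.card ((P.H i).map φ) ≤ ∏ j ∈ Finset.range i, b j := by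
    intro i
    induction i with
    | zero =>
      intro _
      rw [P.bot, Subgroup.map_bot]
      exact ⟨inferInstance, by simp⟩
    | succ i ih =>
      intro hi
      obtain ⟨hfin, hcard⟩ := ih (by omega)
      obtain ⟨t, ht, hgen, htc⟩ := P.exists_factor_generator (i := i) (by omega)
      have hb : 0 < b i ∧ φ t ^ b i ∈ (P.H i).map φ := by
        by_cases hinf : Infinite (F i)
        · simp only [b, if_pos hinf]
          exact ⟨hp, by rw [hexp]; exact Subgroup.one_mem _⟩
        · simp only [b, if_neg hinf]
          have := not_infinite_iff_finite.1 hinf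
          exact ⟨Nat.card_pos, by rw [← map_pow]; exact Subgroup.mem_map_of_mem _ htc⟩
      obtain ⟨h1, h2⟩ := Subgroup.finite_of_generator_mod (B := (P.H (i + 1)).map φ) hb.1 hb.2 (by
        rintro _ ⟨x, hx, rfl⟩
        obtain ⟨k, hk⟩ := hgen x hx
        exact ⟨k, by rw [← map_zpow, ← map_mul]; exact Subgroup.mem_map_of_mem _ hk⟩)
      refine ⟨h1, h2.trans ?_⟩
      rw [Finset.prod_range_succ]
      gcongr
  obtain ⟨h1, h2⟩ := key P.length le_rfl
  rw [P.top, Subgroup.map_top_of_surjective φ hφ] at h1 h2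
  refine ⟨Finite.of_equiv _ Subgroup.topEquiv.toEquiv, ?_⟩
  rw [Subgroup.card_top] at h2
  refine h2.trans ?_
  simp only [b]
  rw [Finset.prod_ite, Finset.prod_const, mul_comm]
  refine Nat.mul_le_mul_left _ (Nat.pow_le_pow_right hp ?_)
  unfold PolycyclicSeries.infiniteFactors at hP
  convert hP

/-! ### Primes not dividing a given integer -/

theorem exists_half_le_theta : ∃ m₀ : ℕ, ∀ m : ℕ, m₀ ≤ m → (m : ℝ) / 2 ≤ Chebyshev.theta m := by
  have h1 : (fun x : ℝ => √x * Real.log x) =o[Filter.atTop] fun x : ℝ => √x * x ^ (1 / 2 : ℝ) :=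
    (Asymptotics.isBigO_refl _ _).mul_isLittleO (isLittleO_log_rpow_atTop (by norm_num))
  -- With 1/40 the error terms, of order √m log m, fit into the gap between log 2 and 1/2.
  have h2 := (h1.bound (c := 1 / 40) (by norm_num)).and (Filter.eventually_ge_atTop (2 : ℝ))
  obtain ⟨m₀, h⟩ := Filter.eventually_atTop.1 (tendsto_natCast_atTop_atTop.eventually h2)
  refine ⟨m₀, fun m hm => ?_⟩
  obtain ⟨hb, hm2⟩ := h m hm
  have hlog : 0 ≤ Real.log m := Real.log_nonneg (by linarith)
  rw [← Real.sqrt_eq_rpow, Real.mul_self_sqrt (by linarith), Real.norm_of_nonneg (by positivity),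
    Real.norm_of_nonneg (by linarith)] at hb
  have hs : 1 ≤ √(m : ℝ) := Real.one_le_sqrt.2 (by linarith)
  have hl1 : Real.log (m + 1) ≤ 2 * Real.log m := by
    rw [← Real.log_rpow (by linarith)]
    refine Real.log_le_log (by linarith) ?_
    norm_num
    nlinarith
  have hl2 : Real.log m ≤ √(m : ℝ) * Real.log m := le_mul_of_one_le_left hlog hs
  have := Chebyshev.theta_ge m
  have hlog2 := Real.log_two_gt_d9
  nlinarith

theorem exists_prime_not_dvd (d A D : ℕ) :
    ∃ K : ℝ, 0 < K ∧ ∀ n : ℕ, 1 ≤ n → ∀ v : ℤ, v ≠ 0 → |v| ≤ A * ((n : ℤ) + 1) ^ D →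
      ∃ p : ℕ, p.Prime ∧ d ≤ p ∧ ¬ (p : ℤ) ∣ v ∧ (p : ℝ) ≤ K * Real.log (2 * n) := by
  obtain ⟨m₀, hm₀⟩ := exists_half_le_theta
  set B : ℝ := Real.log (primorial d * (A + 1 : ℕ)) with hB
  have hprim : (1 : ℝ) ≤ primorial d := by exact_mod_cast primorial_pos d
  have hB0 : 0 ≤ B := Real.log_nonneg (one_le_mul_of_one_le_of_one_le hprim (by simp))
  -- Since ℓ = log (2n) ≥ 1/2, also at n = 1, additive constants are absorbed as B ≤ 2Bℓ and 1 + m₀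
  -- ≤ (2 + 2m₀)ℓ.
  refine ⟨2 * (2 * B + D) + 2 + 2 * m₀, by positivity, ?_⟩
  intro n hn v hv hvn
  have hn' : (1 : ℝ) ≤ n := by exact_mod_cast hn
  set ℓ := Real.log (2 * n) with hℓ
  have hℓ2 : 1 / 2 ≤ ℓ := by
    have := Real.log_two_gt_d9
    have : Real.log 2 ≤ ℓ := Real.log_le_log (by norm_num) (by linarith)
    linarith
  set m : ℕ := ⌊2 * ((2 * B + D) * ℓ)⌋₊ + 1 + m₀ with hm
  have hm1 : 2 * ((2 * B + D) * ℓ) < m := by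
    have := Nat.lt_floor_add_one (2 * ((2 * B + D) * ℓ))
    rw [hm]
    push_cast
    have : (0 : ℝ) ≤ m₀ := by positivity
    linarith
  have hm2 : (m : ℝ) ≤ (2 * (2 * B + D) + 2 + 2 * m₀) * ℓ := by
    have := Nat.floor_le (show 0 ≤ 2 * ((2 * B + D) * ℓ) by positivity)
    rw [hm]
    push_cast
    have : (0 : ℝ) ≤ m₀ := by positivity
    nlinarith
  by_contra! hcon
  -- The factor `primorial d` takes care of the primes below d, which need not divide v.
  have hdvd : primorial m ∣ primorial d * v.natAbs := by
    refine Finset.prod_primes_dvd _ (fun p hp => (Finset.mem_filter.1 hp).2.prime) ?_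
    intro p hp
    obtain ⟨hpm, hpp⟩ := Finset.mem_filter.1 hp
    have hpm' : p ≤ m := by have := Finset.mem_range.1 hpm; omega
    by_cases hpd : d ≤ p
    · by_cases hpv : (p : ℤ) ∣ v
      · exact Dvd.dvd.mul_left (Int.natCast_dvd.1 hpv) _
      · have h1 := hcon p hpp hpd hpv
        have h2 : (p : ℝ) ≤ m := by exact_mod_cast hpm'
        linarith
    · refine Dvd.dvd.mul_right ?_ _
      exact Finset.dvd_prod_of_mem _
        (Finset.mem_filter.2 ⟨Finset.mem_range.2 (by omega), hpp⟩)
  have hle := Nat.le_of_dvd (Nat.mul_pos (primorial_pos d) (Int.natAbs_pos.2 hv)) hdvd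
  have hvR : (v.natAbs : ℝ) ≤ (A + 1 : ℕ) * (2 * n) ^ D := by
    have h1 : (v.natAbs : ℤ) ≤ A * ((n : ℤ) + 1) ^ D := by rwa [Int.natCast_natAbs]
    have h2 : (v.natAbs : ℝ) ≤ A * ((n : ℝ) + 1) ^ D := by exact_mod_cast h1
    refine h2.trans ?_
    push_cast
    gcongr <;> linarith
  have htheta := hm₀ m (by omega)
  rw [Chebyshev.theta_eq_log_primorial, Nat.floor_natCast] at htheta
  have h3 : Real.log (primorial m) ≤ B + D * ℓ := by
    rw [hB, hℓ, ← Real.log_pow, ← Real.log_mul (by positivity) (by positivity)]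
    refine Real.log_le_log (by exact_mod_cast primorial_pos m) ?_
    calc (primorial m : ℝ) ≤ primorial d * v.natAbs := by exact_mod_cast hle
      _ ≤ primorial d * ((A + 1 : ℕ) * (2 * n) ^ D) := by gcongr
      _ = _ := by ring
  nlinarith

/-! ### The upper bound -/

theorem exists_isWordProduct_of_wordLength_le {G : Type u} [Group G] {S : Set G} {g : G} {n : ℕ}
    (h : wordLength S g ≤ n) : ∃ m ≤ n, IsWordProduct S m g := by
  have hne : {k : ℕ∞ | ∃ m : ℕ, k = m ∧ IsWordProduct S m g}.Nonempty := by
    by_contra hemp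
    rw [Set.not_nonempty_iff_eq_empty] at hemp
    rw [wordLength, hemp, sInf_empty] at h
    exact absurd h (by simp)
  obtain ⟨m, hm, hw⟩ := csInf_mem hne
  refine ⟨m, ?_, hw⟩
  rw [wordLength, hm] at h
  exact_mod_cast h

theorem HasSeparatingPolys.exists_prime_notMem_powSubgroup {G : Type u} [Group G]
    (h : HasSeparatingPolys G) {S : Set G} (hS : S.Finite) :
    ∃ K : ℝ, 0 < K ∧ ∀ n : ℕ, 1 ≤ n → ∀ g : G, g ≠ 1 → wordLength S g ≤ n →
      ∃ p : ℕ, p.Prime ∧ g ∉ powSubgroup G p ∧ (p : ℝ) ≤ K * Real.log (2 * n) := by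
  obtain ⟨F, hfin, hpoly, hsep⟩ := h
  have hT : (S ∪ S⁻¹).Finite := hS.union hS.inv
  have key : ∀ f, ∃ K : ℝ, 0 < K ∧ (f ∈ F → ∀ n : ℕ, 1 ≤ n → ∀ g : G, f g ≠ f 1 →
      wordLength S g ≤ n →
        ∃ p : ℕ, p.Prime ∧ g ∉ powSubgroup G p ∧ (p : ℝ) ≤ K * Real.log (2 * n)) := by
    intro f
    by_cases hf : f ∈ F
    · obtain ⟨d, hd⟩ := hpoly f hf
      obtain ⟨A, hA⟩ := hd.abs_prod_le hT
      obtain ⟨K, hK, hprime⟩ := exists_prime_not_dvd d (A + (f 1).natAbs) d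
      refine ⟨K, hK, fun _ n hn g hg hgn => ?_⟩
      obtain ⟨m, hmn, l, rfl, hl, rfl⟩ := exists_isWordProduct_of_wordLength_le hgn
      obtain ⟨p, hp, hdp, hpv, hpK⟩ := hprime n hn (f l.prod - f 1) (sub_ne_zero.2 hg) (by
        have h1 := hA l hl
        have h2 : (1 : ℤ) ≤ ((n : ℤ) + 1) ^ d := one_le_pow₀ (by omega)
        have h3 : ((l.length : ℤ) + 1) ^ d ≤ ((n : ℤ) + 1) ^ d := by gcongr
        push_cast
        rw [add_mul]
        exact (abs_sub _ _).trans (add_le_add (h1.trans (by gcongr))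
          (le_mul_of_one_le_right (abs_nonneg _) h2)))
      exact ⟨p, hp, fun hmem => hpv (hd.prime_dvd_sub_of_mem_powSubgroup hp hdp hmem), hpK⟩
    · exact ⟨1, one_pos, fun h => absurd h hf⟩
  choose K hK hKF using key
  obtain ⟨M, hM⟩ := (hfin.image K).bddAbove
  refine ⟨max M 1, by positivity, fun n hn g hg hgn => ?_⟩
  have : ∃ f ∈ F, f g ≠ f 1 := by
    by_contra! hcon
    exact hg (hsep g hcon)
  obtain ⟨f, hf, hfg⟩ := this
  obtain ⟨p, hp, hgp, hpK⟩ := hKF f hf n hn g hfg hgn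
  refine ⟨p, hp, hgp, hpK.trans ?_⟩
  have hn' : (1 : ℝ) ≤ n := by exact_mod_cast hn
  have : 0 ≤ Real.log (2 * n) := Real.log_nonneg (by linarith)
  have h2 : K f ≤ max M 1 := (hM ⟨f, hf, rfl⟩).trans (le_max_left _ _)
  gcongr

theorem PolycyclicSeries.residualGrowth_asympLE {G : Type u} [Group G] [Group.IsNilpotent G]
    (P : PolycyclicSeries G) (htf : ∀ g : G, IsOfFinOrder g → g = 1) {h : ℕ}
    (hP : P.infiniteFactors ≤ h) {S : Set G} (hS : S.Finite) :
    AsympLE (fun n => ((residualGrowth S n : ℕ∞) : ℝ≥0∞)) (logPow h) := by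
  obtain ⟨K, hK, hprime⟩ := (P.hasSeparatingPolys htf).exists_prime_notMem_powSubgroup hS
  obtain ⟨B, hB⟩ := P.card_le_of_exponent hP
  -- The 2 turns log (2n) into log (Cn); the ceiling is the multiplicative constant.
  refine ⟨2 + ⌈B * K ^ h⌉₊, by omega, fun n hn => ?_⟩
  have hn' : (1 : ℝ) ≤ n := by exact_mod_cast hn
  have hlog : 0 ≤ Real.log (2 * n) := Real.log_nonneg (by linarith)
  set X : ℕ := ⌊B * (K * Real.log (2 * n)) ^ h⌋₊ with hX
  have hle : residualGrowth S n ≤ (X : ℕ∞) := by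
    refine sSup_le ?_
    rintro _ ⟨g, hg, hgn, rfl⟩
    obtain ⟨p, hp, hgp, hpK⟩ := hprime n hn g hg hgn
    obtain ⟨hfin, hcard⟩ := hB p hp.pos (G ⧸ powSubgroup G p) (QuotientGroup.mk' _)
      (QuotientGroup.mk'_surjective _) (pow_eq_one_of_quotient_powSubgroup p)
    have h1 : depth g ≤ Nat.card (G ⧸ powSubgroup G p) :=
      sInf_le ⟨_, _, hfin, QuotientGroup.mk' _, QuotientGroup.mk'_surjective _,
        fun h1 => hgp ((QuotientGroup.eq_one_iff _).1 h1), rfl⟩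
    refine h1.trans ?_
    have h2 : B * p ^ h ≤ X := by
      refine Nat.le_floor ?_
      push_cast
      gcongr
    exact_mod_cast hcard.trans h2
  have hle' : ((residualGrowth S n : ℕ∞) : ℝ≥0∞) ≤ (X : ℝ≥0∞) := by
    have := ENat.toENNReal_le.2 hle
    simpa using this
  refine hle'.trans ?_
  rw [← ENNReal.ofReal_natCast X, ← ENNReal.ofReal_natCast (2 + _), logPow,
    ← ENNReal.ofReal_mul (by positivity)]
  refine ENNReal.ofReal_le_ofReal ((Nat.floor_le (by positivity)).trans ?_)
  rw [mul_pow, ← mul_assoc]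
  have hC := Nat.le_ceil (B * K ^ h)
  have hC2 : (2 : ℝ) ≤ ((2 + ⌈B * K ^ h⌉₊ : ℕ) : ℝ) := by push_cast; simp
  gcongr
  · push_cast
    linarith
  · have h2n : (2 : ℝ) * n ≤ ((2 + ⌈B * K ^ h⌉₊ : ℕ) : ℝ) * n := by gcongr
    push_cast at h2n ⊢
    exact h2n

/-! ### The lower bound -/

/-- An element outside one upper central term has a commutator outside the previous term; iterate
down to the trivial term. -/
theorem exists_leftNormed_ne_one (G : Type*) [Group G] {c : ℕ}
    (hc : Subgroup.upperCentralSeries G c ≠ ⊤) :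
    ∃ w x : ℕ → G, (∀ i, w (i + 1) = ⁅w i, x i⁆) ∧ w c ≠ 1 := by
  have hstep : ∀ (j : ℕ) (g : G), ∃ y, g ∉ Subgroup.upperCentralSeries G (j + 1) →
      ⁅g, y⁆ ∉ Subgroup.upperCentralSeries G j := by
    intro j g
    by_contra! hcon
    exact (hcon 1).1 (Subgroup.mem_upperCentralSeries_succ_iff.2 fun y => (hcon y).2)
  choose Y hY using hstep
  obtain ⟨g, hg⟩ : ∃ g, g ∉ Subgroup.upperCentralSeries G c := by
    by_contra! hcon
    exact hc (eq_top_iff.2 fun g _ => hcon g)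
  let w : ℕ → G := fun i => Nat.rec g (fun i v => ⁅v, Y (c - 1 - i) v⁆) i
  refine ⟨w, fun i => Y (c - 1 - i) (w i), fun i => rfl, ?_⟩
  have key : ∀ i ≤ c, w i ∉ Subgroup.upperCentralSeries G (c - i) := by
    intro i
    induction i with
    | zero => exact fun _ => hg
    | succ i ih =>
      intro hi
      have h1 := ih (by omega)
      rw [show c - i = c - 1 - i + 1 by omega] at h1
      rw [show c - (i + 1) = c - 1 - i by omega]
      exact hY _ _ h1
  have := key c le_rfl
  rwa [Nat.sub_self, Subgroup.upperCentralSeries_zero, Subgroup.mem_bot] at this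

/-- The cosets A t^i with 0 ≤ i < k are distinct. -/
theorem Subgroup.mul_card_le_card {Q : Type*} [Group Q] [Finite Q] {A B : Subgroup Q} (hAB : A ≤ B)
    {t : Q} (ht : t ∈ B) {k : ℕ} (hk : ∀ n : ℕ, t ^ n ∈ A → k ∣ n) :
    k * Nat.card A ≤ Nat.card B := by
  let φ : Fin k × A → B := fun y => ⟨y.2 * t ^ (y.1 : ℕ), B.mul_mem (hAB y.2.2) (B.pow_mem ht _)⟩
  have hle : ∀ (i j : Fin k) (a b : A), (a : Q) * t ^ (i : ℕ) = b * t ^ (j : ℕ) → (i : ℕ) ≤ j →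
      (i : ℕ) = j := by
    intro i j a b hab hij
    have h1 : t ^ ((j : ℕ) - i) ∈ A := by
      have : t ^ ((j : ℕ) - i) = (b : Q)⁻¹ * a := by
        rw [pow_sub _ hij, eq_inv_mul_iff_mul_eq, ← mul_assoc, ← hab, mul_inv_cancel_right]
      rw [this]
      exact A.mul_mem (A.inv_mem b.2) a.2
    have := Nat.eq_zero_of_dvd_of_lt (hk _ h1) (by omega)
    omega
  have hφ : Function.Injective φ := by
    rintro ⟨i, a⟩ ⟨j, b⟩ hab
    have h1 : (a : Q) * t ^ (i : ℕ) = b * t ^ (j : ℕ) := congrArg Subtype.val hab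
    have hij : i = j := by
      apply Fin.ext
      rcases le_total (i : ℕ) j with h | h
      · exact hle i j a b h1 h
      · exact (hle j i b a h1.symm h).symm
    subst hij
    rw [mul_left_inj] at h1
    rw [Subtype.ext h1]
  simpa using Nat.card_le_card_of_injective φ hφ

section LeftNormed

variable {Q : Type*} [Group Q] {w x : ℕ → Q}

theorem leftNormed_mem_lowerCentralSeries (hw : ∀ i, w (i + 1) = ⁅w i, x i⁆) (i : ℕ) :
    w i ∈ (⊤ : Subgroup Q).lowerCentralSeries i := by
  induction i with
  | zero => exact Subgroup.mem_top _
  | succ i ih =>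
    rw [hw]
    exact Subgroup.commutator_mem_commutator ih (Subgroup.mem_top _)

/-- Taking commutators with x i carries the hypothesis from level i to level i + 1, since powers
pass through the commutator modulo the next term. At level c it says that w c ^ n is trivial. -/
theorem orderOf_leftNormed_dvd (hw : ∀ i, w (i + 1) = ⁅w i, x i⁆) {c : ℕ}
    (hc : (⊤ : Subgroup Q).lowerCentralSeries (c + 1) = ⊥) {i j : ℕ} (hij : i + j = c) {n : ℕ}
    (hn : w i ^ n ∈ (⊤ : Subgroup Q).lowerCentralSeries (i + 1)) : orderOf (w c) ∣ n := by
  induction j generalizing i with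
  | zero =>
    obtain rfl : i = c := hij
    rw [hc, Subgroup.mem_bot] at hn
    exact orderOf_dvd_of_pow_eq_one hn
  | succ j ih =>
    refine ih (i := i + 1) (by omega) ?_
    rw [hw, ← commutatorElement_pow_mem_iff]
    · exact Subgroup.commutator_mem_commutator hn (Subgroup.mem_top _)
    · intro g
      rw [← hw]
      exact Subgroup.commutator_mem_commutator (leftNormed_mem_lowerCentralSeries hw _)
        (Subgroup.mem_top _)

theorem pow_orderOf_leftNormed_le_card [Finite Q] (hw : ∀ i, w (i + 1) = ⁅w i, x i⁆) {c : ℕ}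
    (hc1 : 1 ≤ c) (hc : (⊤ : Subgroup Q).lowerCentralSeries (c + 1) = ⊥) :
    orderOf (w c) ^ (c + 2) ≤ Nat.card Q := by
  set k := orderOf (w c) with hk
  let γ := (⊤ : Subgroup Q).lowerCentralSeries
  have hγ : ∀ j i, i + j = c + 1 → k ^ j ≤ Nat.card (γ i) := by
    intro j
    induction j with
    | zero =>
      intro i _
      rw [pow_zero]
      exact Nat.card_pos
    | succ j ih =>
      intro i hij
      rw [pow_succ']
      refine (Nat.mul_le_mul_left k (ih (i + 1) (by omega))).trans ?_
      exact Subgroup.mul_card_le_card (Subgroup.lowerCentralSeries_antitone _ (Nat.le_succ i))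
        (leftNormed_mem_lowerCentralSeries hw i)
        (fun n hn => orderOf_leftNormed_dvd hw hc (j := j) (by omega) hn)
  have hw1 : ∀ n, w 1 ^ n ∈ γ 2 → k ∣ n := fun n hn =>
    orderOf_leftNormed_dvd hw hc (i := 1) (j := c - 1) (by omega) hn
  have hcent : ∀ a b : Q, ⁅a, b⁆ ∈ γ 1 := fun a b =>
    Subgroup.commutator_mem_commutator (Subgroup.mem_top _) (Subgroup.mem_top _)
  have hcent2 : ∀ a b : Q, a ∈ γ 1 → ⁅a, b⁆ ∈ γ 2 := fun a b ha =>
    Subgroup.commutator_mem_commutator ha (Subgroup.mem_top _)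
  have hnormal : ∀ i, (γ i).Normal := fun i => Subgroup.lowerCentralSeries_normal ⊤ i
  -- The extra factor k: x 0 and w 0 are independent modulo γ 1, as a relation between them forces a
  -- power of w 1 = ⁅w 0, x 0⁆ into γ 2.
  have hx : k * Nat.card (γ 1) ≤ Nat.card (γ 1 ⊔ Subgroup.zpowers (x 0) : Subgroup Q) := by
    refine Subgroup.mul_card_le_card le_sup_left
      ((le_sup_right : _ ≤ γ 1 ⊔ _) (Subgroup.mem_zpowers (x 0))) ?_
    intro n hn
    apply hw1
    have h1 : ⁅x 0, w 0⁆ ^ n ∈ γ 2 :=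
      (commutatorElement_pow_mem_iff (γ 2) (fun g => hcent2 _ _ (hcent _ _)) n).1
        (hcent2 _ _ hn)
    rw [hw, ← commutatorElement_inv, inv_pow]
    exact (γ 2).inv_mem h1
  have hw0 : k * Nat.card (γ 1 ⊔ Subgroup.zpowers (x 0) : Subgroup Q) ≤
      Nat.card (⊤ : Subgroup Q) := by
    refine Subgroup.mul_card_le_card le_top (Subgroup.mem_top (w 0)) ?_
    intro n hn
    apply hw1
    rw [hw]
    refine (commutatorElement_pow_mem_iff (γ 2) (fun g => hcent2 _ _ (hcent _ _)) n).1 ?_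
    obtain ⟨u, hu, y, hy, huy⟩ := Subgroup.mem_sup_of_normal_left.1 hn
    obtain ⟨b, rfl⟩ := Subgroup.mem_zpowers_iff.1 hy
    have : ⁅w 0 ^ n, x 0⁆ = ⁅u, x 0⁆ := by
      rw [← huy, commutatorElement_def, commutatorElement_def]; group
    rw [this]
    exact hcent2 _ _ hu
  rw [Subgroup.card_top] at hw0
  calc k ^ (c + 2) = k * (k * k ^ c) := by ring
    _ ≤ k * (k * Nat.card (γ 1)) := by gcongr; exact hγ c 1 (by omega)
    _ ≤ _ := (Nat.mul_le_mul_left k hx).trans hw0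

end LeftNormed

theorem pow_le_depth_pow_lcmUpto {G : Type u} [Group G] {w x : ℕ → G}
    (hw : ∀ i, w (i + 1) = ⁅w i, x i⁆) {c : ℕ} (hc1 : 1 ≤ c)
    (hc : (⊤ : Subgroup G).lowerCentralSeries (c + 1) = ⊥) (m : ℕ) :
    (((m + 1) ^ (c + 2) : ℕ) : ℕ∞) ≤ depth (w c ^ Nat.lcmUpto m) := by
  refine le_sInf ?_
  rintro _ ⟨Q, _, _, φ, hφ, hne, rfl⟩
  have hcQ : (⊤ : Subgroup Q).lowerCentralSeries (c + 1) = ⊥ := by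
    rw [← Subgroup.map_top_of_surjective φ hφ, ← Subgroup.map_lowerCentralSeries, hc,
      Subgroup.map_bot]
  have h := pow_orderOf_leftNormed_le_card (w := φ ∘ w) (x := φ ∘ x)
    (fun i => by simp [hw, map_commutatorElement]) hc1 hcQ
  -- An order at most m would divide the lcm and kill the element.
  have hk : m + 1 ≤ orderOf ((φ ∘ w) c) := by
    by_contra! hlt
    apply hne
    rw [map_pow]
    refine orderOf_dvd_iff_pow_eq_one.1 ?_
    exact Finset.dvd_lcm (f := id)
      (Finset.mem_Icc.2 ⟨orderOf_pos ((φ ∘ w) c), Nat.lt_succ_iff.1 hlt⟩)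
  exact_mod_cast (Nat.pow_le_pow_left hk _).trans h

theorem IsWordProduct.pow {G : Type u} [Group G] {S : Set G} {k : ℕ} {g : G}
    (h : IsWordProduct S k g) (n : ℕ) : IsWordProduct S (n * k) (g ^ n) := by
  obtain ⟨l, rfl, hl, rfl⟩ := h
  refine ⟨(List.replicate n l).flatten, by simp, ?_, by simp⟩
  intro s hs
  simp only [List.mem_flatten, List.mem_replicate] at hs
  obtain ⟨l', ⟨_, rfl⟩, hs⟩ := hs
  exact hl s hs

theorem exists_isWordProduct {G : Type u} [Group G] {S : Set G} (hS : Subgroup.closure S = ⊤)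
    (g : G) : ∃ k, IsWordProduct S k g := by
  have hg : g ∈ (Subgroup.closure S).toSubmonoid := by rw [hS]; exact Submonoid.mem_top g
  rw [Subgroup.closure_toSubmonoid] at hg
  obtain ⟨l, hl, rfl⟩ := Submonoid.exists_list_of_mem_closure hg
  exact ⟨_, l, rfl, hl, rfl⟩

theorem logPow_asympLE_residualGrowth {G : Type u} [Group G] [Group.IsNilpotent G]
    (htf : ∀ g : G, IsOfFinOrder g → g = 1) (hclass : 2 ≤ Group.nilpotencyClass G) {S : Set G}
    (hS : Subgroup.closure S = ⊤) :
    AsympLE (logPow (Group.nilpotencyClass G + 1))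
      (fun n => ((residualGrowth S n : ℕ∞) : ℝ≥0∞)) := by
  obtain ⟨c, hc⟩ : ∃ c, Group.nilpotencyClass G = c + 1 :=
    ⟨_, (Nat.sub_add_cancel (by omega : 1 ≤ Group.nilpotencyClass G)).symm⟩
  rw [hc]
  have hlow : (⊤ : Subgroup G).lowerCentralSeries (c + 1) = ⊥ :=
    Subgroup.lowerCentralSeries_eq_bot_iff_nilpotencyClass_le.2 hc.le
  obtain ⟨w, x, hw, hne⟩ := exists_leftNormed_ne_one G (c := c) (by
    rw [Ne, Subgroup.upperCentralSeries_eq_top_iff_nilpotencyClass_le]; omega)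
  obtain ⟨ℓ, hℓ⟩ := exists_isWordProduct hS (w c)
  -- The constant of Chebyshev's bound ψ(x) ≤ a x, so that m = ⌊log n / a⌋ gives lcm(1, …, m) ≤ n.
  set a : ℝ := Real.log 4 + 4 with ha
  have ha0 : 0 < a := by have := Real.log_nonneg (show (1 : ℝ) ≤ 4 by norm_num); linarith
  -- ℓ pays for the word length of w c, the ceiling for passing from m + 1 back to log n.
  refine ⟨ℓ + ⌈a ^ (c + 2)⌉₊, by have := Nat.ceil_pos.2 (pow_pos ha0 (c + 2)); omega, ?_⟩
  intro n hn
  have hn' : (1 : ℝ) ≤ n := by exact_mod_cast hn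
  have hlog : 0 ≤ Real.log n := Real.log_nonneg hn'
  set m : ℕ := ⌊Real.log n / a⌋₊ with hm
  set L := Nat.lcmUpto m with hL
  have hLpos : 0 < L := Nat.lcmUpto_pos m
  have hLn : L ≤ n := by
    have h1 : Real.log L ≤ Real.log n := by
      rw [hL, ← Chebyshev.psi_eq_log_lcmUpto]
      refine (Chebyshev.psi_le_const_mul_self (by positivity)).trans ?_
      have := Nat.floor_le (show 0 ≤ Real.log n / a by positivity)
      rw [le_div_iff₀ ha0] at this
      linarith
    exact_mod_cast (Real.log_le_log_iff (by exact_mod_cast hLpos) (by linarith)).1 h1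
  have hgrow : (((m + 1) ^ (c + 2) : ℕ) : ℕ∞) ≤
      residualGrowth S ((ℓ + ⌈a ^ (c + 2)⌉₊) * n) := by
    refine (pow_le_depth_pow_lcmUpto hw (by omega) hlow m).trans (le_sSup ⟨_, ?_, ?_, rfl⟩)
    · intro h1
      exact hne (htf _ (isOfFinOrder_iff_pow_eq_one.2 ⟨L, hLpos, h1⟩))
    · refine (sInf_le ⟨L * ℓ, rfl, hℓ.pow L⟩ : wordLength S (w c ^ L) ≤ (L * ℓ : ℕ)).trans ?_
      have : L * ℓ ≤ (ℓ + ⌈a ^ (c + 2)⌉₊) * n := by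
        rw [mul_comm]
        exact Nat.mul_le_mul (Nat.le_add_right _ _) hLn
      exact_mod_cast this
  have hgrow' : (((m + 1) ^ (c + 2) : ℕ) : ℝ≥0∞) ≤
      ((residualGrowth S ((ℓ + ⌈a ^ (c + 2)⌉₊) * n) : ℕ∞) : ℝ≥0∞) := by
    have := ENat.toENNReal_le.2 hgrow
    rwa [ENat.toENNReal_coe] at this
  refine le_trans ?_ (mul_le_mul_right hgrow' _)
  rw [← Nat.cast_mul, ← ENNReal.ofReal_natCast, logPow]
  refine ENNReal.ofReal_le_ofReal ?_
  have h1 : Real.log n ≤ a * (m + 1) := by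
    have := (Nat.lt_floor_add_one (Real.log n / a)).le
    rwa [div_le_iff₀ ha0, mul_comm] at this
  have h2 := Nat.le_ceil (a ^ (c + 2))
  calc Real.log n ^ (c + 1 + 1) ≤ (a * (m + 1)) ^ (c + 2) := by gcongr
    _ = a ^ (c + 2) * (m + 1) ^ (c + 2) := mul_pow _ _ _
    _ ≤ _ := by
      push_cast
      gcongr
      have : (0 : ℝ) ≤ ℓ := by positivity
      linarith

/-! ### The Heisenberg group -/

namespace heisenbergGroup

theorem ext_entries {A B : heisenbergGroup} (h01 : A.1.1 0 1 = B.1.1 0 1)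
    (h12 : A.1.1 1 2 = B.1.1 1 2) (h02 : A.1.1 0 2 = B.1.1 0 2) : A = B := by
  apply Subtype.ext
  apply Matrix.SpecialLinearGroup.ext
  intro i j
  rcases lt_trichotomy i j with h | rfl | h
  · fin_cases i <;> fin_cases j <;> first
      | exact absurd h (by decide)
      | assumption
  · rw [A.2.1, B.2.1]
  · rw [A.2.2 i j h, B.2.2 i j h]

theorem mul_apply (A B : heisenbergGroup) (i j : Fin 3) :
    (A * B).1.1 i j = ∑ k, A.1.1 i k * B.1.1 k j := rfl

theorem mul_zero_one (A B : heisenbergGroup) :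
    (A * B).1.1 0 1 = A.1.1 0 1 + B.1.1 0 1 := by
  rw [mul_apply, Fin.sum_univ_three, A.2.1, B.2.1, B.2.2 2 1 (by decide)]; ring

theorem mul_one_two (A B : heisenbergGroup) :
    (A * B).1.1 1 2 = A.1.1 1 2 + B.1.1 1 2 := by
  rw [mul_apply, Fin.sum_univ_three, A.2.1, B.2.1, A.2.2 1 0 (by decide)]; ring

theorem mul_zero_two (A B : heisenbergGroup) :
    (A * B).1.1 0 2 = A.1.1 0 2 + A.1.1 0 1 * B.1.1 1 2 + B.1.1 0 2 := by
  rw [mul_apply, Fin.sum_univ_three, A.2.1, B.2.1]; ring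

/-- The entry in position `(0, 1)`. -/
def entryX : heisenbergGroup →* Multiplicative ℤ :=
  MonoidHom.mk' (fun A => Multiplicative.ofAdd (A.1.1 0 1)) mul_zero_one

/-- The entry in position `(1, 2)`. -/
def entryY : heisenbergGroup →* Multiplicative ℤ :=
  MonoidHom.mk' (fun A => Multiplicative.ofAdd (A.1.1 1 2)) mul_one_two

theorem mem_ker_entryX {A : heisenbergGroup} : A ∈ entryX.ker ↔ A.1.1 0 1 = 0 := Iff.rfl

theorem mem_ker_entryY {A : heisenbergGroup} : A ∈ entryY.ker ↔ A.1.1 1 2 = 0 := Iff.rfl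

/-- The entry in position `(0, 2)` of a central element. -/
def entryZ : (entryX.ker ⊓ entryY.ker : Subgroup heisenbergGroup) →* Multiplicative ℤ :=
  MonoidHom.mk' (fun A => Multiplicative.ofAdd (A.1.1.1 0 2)) (by
    intro A B
    refine congrArg Multiplicative.ofAdd ((mul_zero_two A.1 B.1).trans ?_)
    rw [mem_ker_entryX.1 A.2.1, zero_mul, add_zero]
    rfl)

theorem entryZ_injective : Function.Injective entryZ := by
  intro A B hAB
  refine Subtype.ext (ext_entries ?_ ?_ hAB)
  · exact (mem_ker_entryX.1 A.2.1).trans (mem_ker_entryX.1 B.2.1).symm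
  · exact (mem_ker_entryY.1 A.2.2).trans (mem_ker_entryY.1 B.2.2).symm

theorem eq_one_of_isOfFinOrder_int (z : Multiplicative ℤ) (h : IsOfFinOrder z) : z = 1 := by
  by_contra hz
  exact not_isOfFinOrder_of_isMulTorsionFree hz h

theorem eq_one_of_isOfFinOrder (A : heisenbergGroup) (h : IsOfFinOrder A) : A = 1 := by
  have hx : A ∈ entryX.ker := eq_one_of_isOfFinOrder_int _ (entryX.isOfFinOrder h)
  have hy : A ∈ entryY.ker := eq_one_of_isOfFinOrder_int _ (entryY.isOfFinOrder h)
  have hA : IsOfFinOrder (⟨A, hx, hy⟩ : (entryX.ker ⊓ entryY.ker : Subgroup _)) :=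
    Submonoid.isOfFinOrder_coe.1 h
  have hz := eq_one_of_isOfFinOrder_int _ (entryZ.isOfFinOrder hA)
  exact congrArg Subtype.val (entryZ_injective (hz.trans (map_one entryZ).symm))

theorem ker_prod_le_center : (entryX.prod entryY).ker ≤ Subgroup.center heisenbergGroup := by
  intro A hA
  rw [MonoidHom.ker_prod] at hA
  have hx := mem_ker_entryX.1 hA.1
  have hy := mem_ker_entryY.1 hA.2
  rw [Subgroup.mem_center_iff]
  intro B
  apply ext_entries
  · rw [mul_zero_one, mul_zero_one, add_comm]
  · rw [mul_one_two, mul_one_two, add_comm]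
  · rw [mul_zero_two, mul_zero_two, hx, hy]; ring

instance isNilpotent : Group.IsNilpotent heisenbergGroup :=
  Subgroup.isNilpotent_of_ker_le_center _ ker_prod_le_center

theorem nilpotencyClass_eq_two : Group.nilpotencyClass heisenbergGroup = 2 := by
  apply le_antisymm
  · have h1 := Group.nilpotencyClass_le_of_ker_le_center _ ker_prod_le_center
    have h2 : Group.nilpotencyClass (Multiplicative ℤ × Multiplicative ℤ) ≤ 1 :=
      CommGroup.nilpotencyClass_le_one
    omega
  · by_contra hlt
    have hcomm := (Group.IsNilpotent.nilpotencyClass_le_one_iff (G := heisenbergGroup)).1 (by omega)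
    let a : heisenbergGroup := ⟨⟨!![1, 1, 0; 0, 1, 0; 0, 0, 1], by simp [Matrix.det_fin_three]⟩,
      fun i => by fin_cases i <;> rfl,
      fun i j hij => by fin_cases i <;> fin_cases j <;> first | exact absurd hij (by decide) | rfl⟩
    let b : heisenbergGroup := ⟨⟨!![1, 0, 0; 0, 1, 1; 0, 0, 1], by simp [Matrix.det_fin_three]⟩,
      fun i => by fin_cases i <;> rfl,
      fun i j hij => by fin_cases i <;> fin_cases j <;> first | exact absurd hij (by decide) | rfl⟩
    -- The (0, 2) entry is 1 for a * b and 0 for b * a.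
    have h := congrArg (fun A : heisenbergGroup => A.1.1 0 2) (hcomm.is_comm.comm a b)
    simp only [mul_zero_two] at h
    simp [a, b] at h

theorem factor_of_hom {G : Type*} [Group G] {H K : Subgroup G} (θ : K →* Multiplicative ℤ)
    (hθ : θ.ker = H.subgroupOf K) :
    ∃ _ : (H.subgroupOf K).Normal, IsCyclic (K ⧸ H.subgroupOf K) := by
  rw [← hθ]
  exact ⟨inferInstance, isCyclic_of_injective _ (QuotientGroup.kerLift_injective θ)⟩

/-- The series given by the center and the kernel of `entryX`. -/
def series : PolycyclicSeries heisenbergGroup where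
  length := 3
  H
    | 0 => ⊥
    | 1 => entryX.ker ⊓ entryY.ker
    | 2 => entryX.ker
    | _ => ⊤
  bot := rfl
  top := rfl
  le := by
    intro i hi
    interval_cases i
    · exact bot_le
    · exact inf_le_left
    · exact le_top
  factor := by
    intro i hi
    interval_cases i
    · refine factor_of_hom entryZ ?_
      rw [(MonoidHom.ker_eq_bot_iff _).2 entryZ_injective]
      exact (Subgroup.bot_subgroupOf _).symm
    · refine factor_of_hom (entryY.comp entryX.ker.subtype) ?_
      ext A
      exact ⟨fun h => ⟨A.2, h⟩, fun h => h.2⟩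
    · refine factor_of_hom (entryX.comp (⊤ : Subgroup heisenbergGroup).subtype) ?_
      ext A
      exact Iff.rfl

theorem infiniteFactors_series_le : series.infiniteFactors ≤ 3 := by
  classical
  refine le_trans ?_ (Finset.card_range 3).le
  unfold PolycyclicSeries.infiniteFactors
  exact Finset.card_filter_le (Finset.range 3) _

end heisenbergGroup

/-! ### Combining the two bounds -/

/-- One series with few enough infinite factors suffices, so neither the invariance of the Hirsch
length nor its value for the Heisenberg group is needed. -/
theorem residualGrowthEquiv_of_series {G : Type u} [Group G] [Group.IsNilpotent G]
    (htf : ∀ g : G, IsOfFinOrder g → g = 1) (hclass : 2 ≤ Group.nilpotencyClass G)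
    (P : PolycyclicSeries G) (hP : P.infiniteFactors ≤ Group.nilpotencyClass G + 1) :
    ResidualGrowthEquiv G (logPow (Group.nilpotencyClass G + 1)) :=
  fun _ hfin hgen => ⟨P.residualGrowth_asympLE htf hP hfin,
    logPow_asympLE_residualGrowth htf hclass hgen⟩

theorem IsFiliform.residualGrowthEquiv {N : Type u} [Group N] (h : IsFiliform N) :
    ResidualGrowthEquiv N (logPow (hirschLength N)) := by
  have := h.nilpotent
  have h3 := h.three_le
  have hstep := h.step
  -- The infimum of the empty set is 0, so a positive Hirsch length guarantees that a series exists.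
  have hne : {k : ℕ | ∃ P : PolycyclicSeries N, P.infiniteFactors = k}.Nonempty :=
    Nat.nonempty_of_sInf_eq_succ (k := hirschLength N - 1)
      (show hirschLength N = hirschLength N - 1 + 1 by omega)
  obtain ⟨P, hP⟩ := Nat.sInf_mem hne
  rw [← hstep]
  refine residualGrowthEquiv_of_series h.torsionFree (by omega) P ?_
  rw [hP]
  exact hstep.ge

theorem heisenbergGroup.residualGrowthEquiv : ResidualGrowthEquiv heisenbergGroup (logPow 3) := by
  have h := residualGrowthEquiv_of_series heisenbergGroup.eq_one_of_isOfFinOrder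
    heisenbergGroup.nilpotencyClass_eq_two.ge heisenbergGroup.series
    (by rw [heisenbergGroup.nilpotencyClass_eq_two]
        exact heisenbergGroup.infiniteFactors_series_le)
  rwa [heisenbergGroup.nilpotencyClass_eq_two] at h

theorem mainTheorem4 :
    (∀ (N : Type u) [Group N], IsFiliform N →
      ResidualGrowthEquiv N (logPow (hirschLength N))) ∧
    ResidualGrowthEquiv heisenbergGroup (logPow 3) :=
  ⟨fun _ _ h => h.residualGrowthEquiv, heisenbergGroup.residualGrowthEquiv⟩
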